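/- Let $G=T^*H_1(\mathbb{R})$ be the simply connected 6-dimensional 2-step nilpotent Lie group given by the space $\mathbb{R}^6$ with the product $$(x_1,x_2,x_3,y_1,y_2,y_3)(x'_1,x'_2,x'_3,y'_1,y'_2,y'_3)=(x_1+x'_1+y_2y'_3,\;x_2+x'_2+y_3y'_1,\;x_3+x'_3+y_1y'_2,\;y_1+y'_1,\;y_2+y'_2,\;y_3+y'_3).$$ A lattice of $G$ is a discrete subgroup $\Gamma$ with $\Gamma\backslash G$ compact. For positive integers $d_1,d_2,d_3$ with $d_1\mid d_2\mid d_3$, let $\Gamma_{d_1,d_2,d_3}$ be the group $\mathbb{Z}^6$ with the multiplication $$(a_1,a_2,a_3,b_1,b_2,b_3)(a'_1,a'_2,a'_3,b'_1,b'_2,b'_3)=(a_1+a'_1+d_1b_2b'_3,\;a_2+a'_2+d_2b_3b'_1,\;a_3+a'_3+d_3b_1b'_2,\;b_1+b'_1,\;b_2+b'_2,\;b_3+b'_3).$$ Then the following hold. (i) Every lattice of $G$ is isomorphic, as a group, to $\Gamma_{d_1,d_2,d_3}$ for some positive integers $d_1\mid d_2\mid d_3$. (ii) Conversely, for all positive integers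 $d_1\mid d_2\mid d_3$, the group $\Gamma_{d_1,d_2,d_3}$ is isomorphic to a lattice of $G$. (iii) The derived group $D$ of $\Gamma_{d_1,d_2,d_3}$ is contained in its center $Z$, and $Z/D\cong C_{d_1}\times C_{d_2}\times C_{d_3}$, where $C_d$ is the cyclic group of order $d$. (iv) If $d_1\mid d_2\mid d_3$ and $e_1\mid e_2\mid e_3$ are two triples of positive integers with $\Gamma_{d_1,d_2,d_3}\cong\Gamma_{e_1,e_2,e_3}$, then $(d_1,d_2,d_3)=(e_1,e_2,e_3)$. Consequently the isomorphism classes of lattices of $G$ correspond bijectively to the triples of positive integers $d_1\mid d_2\mid d_3$. -/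

import Mathlib

/-- The simply connected Lie group `T* H₁(ℝ)`, the cotangent bundle of the real Heisenberg group,
in its standard global coordinates `(x₁, x₂, x₃, y₁, y₂, y₃) ∈ ℝ⁶`. The indices `1, 2, 3` are
written `0, 1, 2`. -/
@[ext]
structure CotangentHeisenberg where
  /-- the central coordinates -/
  x : Fin 3 → ℝ
  /-- the coordinates modulo the center -/
  y : Fin 3 → ℝ

namespace CotangentHeisenberg

instance : Mul CotangentHeisenberg where
  mul s t :=
    { x := ![s.x 0 + t.x 0 + s.y 1 * t.y 2,
             s.x 1 + t.x 1 + s.y 2 * t.y 0,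
             s.x 2 + t.x 2 + s.y 0 * t.y 1]
      y := s.y + t.y }

instance : One CotangentHeisenberg where
  one := { x := 0, y := 0 }

instance : Inv CotangentHeisenberg where
  inv s :=
    { x := ![-s.x 0 + s.y 1 * s.y 2, -s.x 1 + s.y 2 * s.y 0, -s.x 2 + s.y 0 * s.y 1]
      y := -s.y }

theorem mul_def (s t : CotangentHeisenberg) :
    s * t =
      { x := ![s.x 0 + t.x 0 + s.y 1 * t.y 2,
               s.x 1 + t.x 1 + s.y 2 * t.y 0,
               s.x 2 + t.x 2 + s.y 0 * t.y 1]
        y := s.y + t.y } := rfl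

theorem one_def : (1 : CotangentHeisenberg) = { x := 0, y := 0 } := rfl

theorem inv_def (s : CotangentHeisenberg) :
    s⁻¹ =
      { x := ![-s.x 0 + s.y 1 * s.y 2, -s.x 1 + s.y 2 * s.y 0, -s.x 2 + s.y 0 * s.y 1]
        y := -s.y } := rfl

instance : Group CotangentHeisenberg :=
  Group.ofLeftAxioms
    (fun s t u => by
      ext i <;> fin_cases i <;> simp [mul_def] <;> ring)
    (fun s => by
      ext i <;> fin_cases i <;> simp [mul_def, one_def])
    (fun s => by
      ext i <;> fin_cases i <;> simp [mul_def, one_def, inv_def])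

/-- The topology of `ℝ⁶`. -/
instance : TopologicalSpace CotangentHeisenberg :=
  TopologicalSpace.induced (fun s => (s.x, s.y)) inferInstance

theorem continuous_x : Continuous CotangentHeisenberg.x :=
  Continuous.fst (f := fun s : CotangentHeisenberg => (s.x, s.y)) continuous_induced_dom

theorem continuous_y : Continuous CotangentHeisenberg.y :=
  Continuous.snd (f := fun s : CotangentHeisenberg => (s.x, s.y)) continuous_induced_dom

instance : IsTopologicalGroup CotangentHeisenberg where
  continuous_mul := by
    have hx (i : Fin 3) : Continuous fun s : CotangentHeisenberg => s.x i :=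
      (continuous_apply i).comp continuous_x
    have hy (i : Fin 3) : Continuous fun s : CotangentHeisenberg => s.y i :=
      (continuous_apply i).comp continuous_y
    refine continuous_induced_rng.2 (Continuous.prodMk (continuous_pi fun i => ?_)
      ((continuous_y.comp continuous_fst).add (continuous_y.comp continuous_snd)))
    fin_cases i
    · exact (((hx 0).comp continuous_fst).add ((hx 0).comp continuous_snd)).add
        (((hy 1).comp continuous_fst).mul ((hy 2).comp continuous_snd))
    · exact (((hx 1).comp continuous_fst).add ((hx 1).comp continuous_snd)).add
        (((hy 2).comp continuous_fst).mul ((hy 0).comp continuous_snd))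
    · exact (((hx 2).comp continuous_fst).add ((hx 2).comp continuous_snd)).add
        (((hy 0).comp continuous_fst).mul ((hy 1).comp continuous_snd))
  continuous_inv := by
    have hx (i : Fin 3) : Continuous fun s : CotangentHeisenberg => s.x i :=
      (continuous_apply i).comp continuous_x
    have hy (i : Fin 3) : Continuous fun s : CotangentHeisenberg => s.y i :=
      (continuous_apply i).comp continuous_y
    refine continuous_induced_rng.2 (Continuous.prodMk (continuous_pi fun i => ?_)
      continuous_y.neg)
    fin_cases i
    · exact (hx 0).neg.add ((hy 1).mul (hy 2))
    · exact (hx 1).neg.add ((hy 2).mul (hy 0))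
    · exact (hx 2).neg.add ((hy 0).mul (hy 1))

end CotangentHeisenberg

/-- A (uniform) lattice of a topological group: a discrete subgroup with compact quotient space. -/
structure IsUniformLattice {G : Type*} [Group G] [TopologicalSpace G] (Γ : Subgroup G) :
    Prop where
  /-- the subgroup is discrete -/
  discrete : DiscreteTopology Γ
  /-- the space of cosets is compact -/
  cocompact : CompactSpace (G ⧸ Γ)

/-- The group `Γ_{d₁,d₂,d₃}` of all `(a₁, a₂, a₃, b₁, b₂, b₃) ∈ ℤ⁶`, with the multiplication
twisted by `d₁, d₂, d₃`. The indices `1, 2, 3` of the coordinates are written `0, 1, 2`. -/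
@[ext]
structure TwistedLattice (d₁ d₂ d₃ : ℕ) where
  /-- the central coordinates -/
  a : Fin 3 → ℤ
  /-- the coordinates modulo the center -/
  b : Fin 3 → ℤ

namespace TwistedLattice

instance (d₁ d₂ d₃ : ℕ) : Mul (TwistedLattice d₁ d₂ d₃) where
  mul s t :=
    { a := ![s.a 0 + t.a 0 + d₁ * s.b 1 * t.b 2,
             s.a 1 + t.a 1 + d₂ * s.b 2 * t.b 0,
             s.a 2 + t.a 2 + d₃ * s.b 0 * t.b 1]
      b := s.b + t.b }

instance (d₁ d₂ d₃ : ℕ) : One (TwistedLattice d₁ d₂ d₃) where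
  one := { a := 0, b := 0 }

instance (d₁ d₂ d₃ : ℕ) : Inv (TwistedLattice d₁ d₂ d₃) where
  inv s :=
    { a := ![-s.a 0 + d₁ * s.b 1 * s.b 2, -s.a 1 + d₂ * s.b 2 * s.b 0,
             -s.a 2 + d₃ * s.b 0 * s.b 1]
      b := -s.b }

theorem mul_def {d₁ d₂ d₃ : ℕ} (s t : TwistedLattice d₁ d₂ d₃) :
    s * t =
      { a := ![s.a 0 + t.a 0 + d₁ * s.b 1 * t.b 2,
               s.a 1 + t.a 1 + d₂ * s.b 2 * t.b 0,
               s.a 2 + t.a 2 + d₃ * s.b 0 * t.b 1]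
        b := s.b + t.b } := rfl

theorem one_def {d₁ d₂ d₃ : ℕ} : (1 : TwistedLattice d₁ d₂ d₃) = { a := 0, b := 0 } := rfl

theorem inv_def {d₁ d₂ d₃ : ℕ} (s : TwistedLattice d₁ d₂ d₃) :
    s⁻¹ =
      { a := ![-s.a 0 + d₁ * s.b 1 * s.b 2, -s.a 1 + d₂ * s.b 2 * s.b 0,
               -s.a 2 + d₃ * s.b 0 * s.b 1]
        b := -s.b } := rfl

instance (d₁ d₂ d₃ : ℕ) : Group (TwistedLattice d₁ d₂ d₃) :=
  Group.ofLeftAxioms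
    (fun s t u => by
      ext i <;> fin_cases i <;> simp [mul_def] <;> ring)
    (fun s => by
      ext i <;> fin_cases i <;> simp [mul_def, one_def])
    (fun s => by
      ext i <;> fin_cases i <;> simp [mul_def, one_def, inv_def])

end TwistedLattice

/-! A commutator in `G` is `(y × y', 0)`: the skew part of the cocycle is the cross product. For a
lattice `Γ`, let `L` be its projection to the `y`-coordinates and `M` its central part, so `L × L ⊆
M`. Cocompactness makes `L` span `ℝ³` (`span_projection_eq_top`). Discreteness of `Γ` passes to `M`,
and then to `L`, since a short vector of `L` has short cross products, lying in `M`, with a fixed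
basis (`exists_nhds_projection`). So `L` and `M` are lattices in `ℝ³`.

Let the rows of `V` and `P` be bases of `L` and `M`. The rows of the cofactor matrix `cof V =
V.adjugateᵀ` are cross products of rows of `V`, so `cof V = C * P` with `C` integral and
nonsingular. Replacing `V` by `cof U * V` with `det U = 1` replaces `C` by `U * C`, because `cof
(cof U) = det U • U`; changing `P` acts on the right of `C`. Smith normal form thus gives `cof V =
diagonal d * P`. Along `V` the cocycles then differ by a symmetric bilinear form, which is the
coboundary of half its quadratic form; this correction defines an isomorphism from `Γ_d` onto `Γ`.

Conversely, dividing the central coordinates by the `dᵢ` embeds `Γ_d` as a lattice. Its center is `b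
= 0` and its derived group is `d₁ℤ × d₂ℤ × d₃ℤ` inside it, so center modulo derived group recovers
the `dᵢ` as invariant factors. -/

open scoped commutatorElement

/-! ### Center and derived group of `Γ_d` -/

namespace TwistedLattice

variable {d₁ d₂ d₃ : ℕ}

/-- The projection onto the coordinates modulo the center. -/
def bHom : TwistedLattice d₁ d₂ d₃ →* Multiplicative (Fin 3 → ℤ) where
  toFun s := Multiplicative.ofAdd s.b
  map_one' := rfl
  map_mul' _ _ := rfl

/-- The reduction of the central coordinates modulo `d₁, d₂, d₃`. -/
def residueHom : TwistedLattice d₁ d₂ d₃ →* Multiplicative (ZMod d₁ × ZMod d₂ × ZMod d₃) where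
  toFun s := Multiplicative.ofAdd ((s.a 0 : ZMod d₁), (s.a 1 : ZMod d₂), (s.a 2 : ZMod d₃))
  map_one' := by simp [one_def]
  map_mul' s t := by
    rw [← ofAdd_add]
    simp [mul_def]

theorem mem_center_iff (h₂ : 1 ≤ d₂) (h₃ : 1 ≤ d₃) {s : TwistedLattice d₁ d₂ d₃} :
    s ∈ Subgroup.center (TwistedLattice d₁ d₂ d₃) ↔ s.b = 0 := by
  rw [Subgroup.mem_center_iff]
  constructor
  · intro h
    -- Commuting with the first generator forces `b 1 = b 2 = 0`, with the second `b 0 = 0`; only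
    -- `d₂` and `d₃` have to be cancelled.
    have h0 := congrArg (fun t => t.a) (h ⟨0, ![1, 0, 0]⟩)
    have h1 := congrArg (fun t => t.a) (h ⟨0, ![0, 1, 0]⟩)
    have e1 := congrFun h0 1
    have e2 := congrFun h0 2
    have e0 := congrFun h1 2
    simp [mul_def] at e0 e1 e2
    ext i
    fin_cases i <;> simp <;> omega
  · intro h t
    ext i <;> fin_cases i <;> simp [mul_def, h] <;> ring

theorem commutatorElement_eq (s t : TwistedLattice d₁ d₂ d₃) :
    ⁅s, t⁆ =
      { a := ![d₁ * (s.b 1 * t.b 2 - s.b 2 * t.b 1), d₂ * (s.b 2 * t.b 0 - s.b 0 * t.b 2),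
               d₃ * (s.b 0 * t.b 1 - s.b 1 * t.b 0)]
        b := 0 } := by
  rw [commutatorElement_def, mul_inv_eq_iff_eq_mul, mul_inv_eq_iff_eq_mul]
  ext i <;> fin_cases i <;> simp [mul_def] <;> ring

/-- Both homomorphisms have abelian targets, so they kill commutators. Conversely, commutators are
bilinear in `b`, and each central coordinate divisible by its `dᵢ` is a single commutator. -/
theorem mem_commutator_iff {s : TwistedLattice d₁ d₂ d₃} :
    s ∈ commutator (TwistedLattice d₁ d₂ d₃) ↔ s.b = 0 ∧ residueHom s = 1 := by
  constructor
  · intro h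
    exact ⟨Abelianization.commutator_subset_ker bHom h,
      MonoidHom.mem_ker.1 (Abelianization.commutator_subset_ker residueHom h)⟩
  · rintro ⟨hb, hr⟩
    have hr' : ((s.a 0 : ZMod d₁), (s.a 1 : ZMod d₂), (s.a 2 : ZMod d₃)) = (0, 0, 0) := hr
    simp only [Prod.mk.injEq, ZMod.intCast_zmod_eq_zero_iff_dvd] at hr'
    obtain ⟨⟨k₀, e₀⟩, ⟨k₁, e₁⟩, ⟨k₂, e₂⟩⟩ := hr'
    have hs : s = ⁅(⟨0, ![0, k₀, 0]⟩ : TwistedLattice d₁ d₂ d₃), ⟨0, ![0, 0, 1]⟩⁆ *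
        ⁅(⟨0, ![0, 0, k₁]⟩ : TwistedLattice d₁ d₂ d₃), ⟨0, ![1, 0, 0]⟩⁆ *
        ⁅(⟨0, ![k₂, 0, 0]⟩ : TwistedLattice d₁ d₂ d₃), ⟨0, ![0, 1, 0]⟩⁆ := by
      simp only [commutatorElement_eq]
      ext i <;> fin_cases i <;> simp [mul_def, hb, e₀, e₁, e₂]
    have hc (t u : TwistedLattice d₁ d₂ d₃) : ⁅t, u⁆ ∈ commutator (TwistedLattice d₁ d₂ d₃) :=
      Subgroup.commutator_mem_commutator (Subgroup.mem_top t) (Subgroup.mem_top u)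
    rw [hs]
    exact mul_mem (mul_mem (hc _ _) (hc _ _)) (hc _ _)

theorem commutator_le_center (h₂ : 1 ≤ d₂) (h₃ : 1 ≤ d₃) :
    commutator (TwistedLattice d₁ d₂ d₃) ≤ Subgroup.center (TwistedLattice d₁ d₂ d₃) :=
  fun _ hs => (mem_center_iff h₂ h₃).2 (mem_commutator_iff.1 hs).1

/-- The center modulo the derived group is `C_{d₁} × C_{d₂} × C_{d₃}`. -/
theorem nonempty_center_quotient_mulEquiv (h₂ : 1 ≤ d₂) (h₃ : 1 ≤ d₃) :
    Nonempty
      ((Subgroup.center (TwistedLattice d₁ d₂ d₃) ⧸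
          (commutator (TwistedLattice d₁ d₂ d₃)).subgroupOf
            (Subgroup.center (TwistedLattice d₁ d₂ d₃))) ≃*
        Multiplicative (ZMod d₁ × ZMod d₂ × ZMod d₃)) := by
  let f := (residueHom (d₁ := d₁) (d₂ := d₂) (d₃ := d₃)).comp
    (Subgroup.center (TwistedLattice d₁ d₂ d₃)).subtype
  have hker : (commutator (TwistedLattice d₁ d₂ d₃)).subgroupOf
      (Subgroup.center (TwistedLattice d₁ d₂ d₃)) = f.ker := by
    ext s
    rw [Subgroup.mem_subgroupOf, mem_commutator_iff, MonoidHom.mem_ker]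
    exact and_iff_right ((mem_center_iff h₂ h₃).1 s.2)
  have hsurj : Function.Surjective f := by
    intro z
    obtain ⟨x, hx⟩ := ZMod.intCast_surjective z.toAdd.1
    obtain ⟨y, hy⟩ := ZMod.intCast_surjective z.toAdd.2.1
    obtain ⟨w, hw⟩ := ZMod.intCast_surjective z.toAdd.2.2
    refine ⟨⟨⟨![x, y, w], 0⟩, (mem_center_iff h₂ h₃).2 rfl⟩, ?_⟩
    apply Multiplicative.toAdd.injective
    exact Prod.ext hx (Prod.ext hy hw)
  exact ⟨(QuotientGroup.quotientMulEquivOfEq hker).trans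
    (QuotientGroup.quotientKerEquivOfSurjective f hsurj)⟩

end TwistedLattice

/-! ### Uniqueness of invariant factors -/

/-- The number of elements of `ℤ/d₁ × ℤ/d₂ × ℤ/d₃` killed by `n`. -/
theorem card_nsmul_ker_zmod_prod {d₁ d₂ d₃ : ℕ} (h₁ : 1 ≤ d₁) (h₂ : 1 ≤ d₂) (h₃ : 1 ≤ d₃)
    (n : ℕ) :
    Nat.card {z : ZMod d₁ × ZMod d₂ × ZMod d₃ // n • z = 0} =
      d₁.gcd n * (d₂.gcd n * d₃.gcd n) := by
  have key (d : ℕ) (h : 1 ≤ d) : Nat.card {z : ZMod d // n • z = 0} = d.gcd n := by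
    have : NeZero d := ⟨by omega⟩
    have := IsAddCyclic.card_nsmulAddMonoidHom_ker (G := ZMod d) n
    rw [Nat.card_zmod] at this
    exact this
  rw [← key d₁ h₁, ← key d₂ h₂, ← key d₃ h₃, ← Nat.card_prod, ← Nat.card_prod]
  refine Nat.card_congr
    { toFun z := (⟨z.1.1, congrArg Prod.fst z.2⟩, ⟨z.1.2.1, congrArg (fun t => t.2.1) z.2⟩,
        ⟨z.1.2.2, congrArg (fun t => t.2.2) z.2⟩)
      invFun z := ⟨(z.1.1, z.2.1.1, z.2.2.1),
        Prod.ext z.1.2 (Prod.ext z.2.1.2 z.2.2.2)⟩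
      left_inv _ := rfl
      right_inv _ := rfl }

/-- The invariant factors of a product of three finite cyclic groups divide those of an isomorphic
one. -/
theorem invariantFactors_dvd_of_addEquiv {d₁ d₂ d₃ e₁ e₂ e₃ : ℕ}
    (hd₁ : 1 ≤ d₁) (hd₂ : 1 ≤ d₂) (hd₃ : 1 ≤ d₃) (hd₁₂ : d₁ ∣ d₂) (hd₂₃ : d₂ ∣ d₃)
    (he₁ : 1 ≤ e₁) (he₂ : 1 ≤ e₂) (he₃ : 1 ≤ e₃)
    (f : ZMod d₁ × ZMod d₂ × ZMod d₃ ≃+ ZMod e₁ × ZMod e₂ × ZMod e₃) :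
    d₁ ∣ e₁ ∧ (e₁ = d₁ → d₂ ∣ e₂) ∧ (e₁ = d₁ → e₂ = d₂ → d₃ ∣ e₃) := by
  have key (n : ℕ) : d₁.gcd n * (d₂.gcd n * d₃.gcd n) = e₁.gcd n * (e₂.gcd n * e₃.gcd n) := by
    rw [← card_nsmul_ker_zmod_prod hd₁ hd₂ hd₃, ← card_nsmul_ker_zmod_prod he₁ he₂ he₃]
    refine Nat.card_congr (f.toEquiv.subtypeEquiv fun z => ?_)
    change n • z = 0 ↔ n • f z = 0
    rw [← map_nsmul, map_eq_zero_iff f f.injective]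
  have le (n e : ℕ) (hn : 1 ≤ n) : e.gcd n ≤ n := Nat.gcd_le_right e hn
  have dvd {n e : ℕ} (h : n ≤ e.gcd n) (hn : 1 ≤ n) : n ∣ e := by
    have : e.gcd n = n := le_antisymm (Nat.gcd_le_right e hn) h
    rw [← this]
    exact Nat.gcd_dvd_left e n
  refine ⟨?_, ?_, ?_⟩
  -- For `n = d₁` the left side is `d₁³` and each factor on the right is at most `d₁`, so `gcd(e₁,
  -- d₁) = d₁`. The other cases repeat this after cancelling the factors already known.
  · have h := key d₁
    rw [Nat.gcd_self, Nat.gcd_eq_right hd₁₂, Nat.gcd_eq_right (hd₁₂.trans hd₂₃)] at h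
    refine dvd (le_of_mul_le_mul_right ?_ (Nat.mul_pos hd₁ hd₁)) hd₁
    rw [h]
    exact Nat.mul_le_mul_left _ (Nat.mul_le_mul (le _ _ hd₁) (le _ _ hd₁))
  · rintro rfl
    have h := key d₂
    rw [Nat.gcd_self, Nat.gcd_eq_left hd₁₂, Nat.gcd_eq_right hd₂₃] at h
    have h := Nat.eq_of_mul_eq_mul_left he₁ h
    refine dvd (le_of_mul_le_mul_right ?_ hd₂) hd₂
    rw [h]
    exact Nat.mul_le_mul_left _ (le _ _ hd₂)
  · rintro rfl rfl
    have h := key d₃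
    rw [Nat.gcd_self, Nat.gcd_eq_left hd₂₃, Nat.gcd_eq_left (hd₁₂.trans hd₂₃)] at h
    have h := Nat.eq_of_mul_eq_mul_left he₂ (Nat.eq_of_mul_eq_mul_left he₁ h)
    exact dvd h.le hd₃

/-- The invariant factors of a product of three finite cyclic groups are unique. -/
theorem invariantFactors_eq_of_addEquiv {d₁ d₂ d₃ e₁ e₂ e₃ : ℕ}
    (hd₁ : 1 ≤ d₁) (hd₂ : 1 ≤ d₂) (hd₃ : 1 ≤ d₃) (hd₁₂ : d₁ ∣ d₂) (hd₂₃ : d₂ ∣ d₃)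
    (he₁ : 1 ≤ e₁) (he₂ : 1 ≤ e₂) (he₃ : 1 ≤ e₃) (he₁₂ : e₁ ∣ e₂) (he₂₃ : e₂ ∣ e₃)
    (f : ZMod d₁ × ZMod d₂ × ZMod d₃ ≃+ ZMod e₁ × ZMod e₂ × ZMod e₃) :
    d₁ = e₁ ∧ d₂ = e₂ ∧ d₃ = e₃ := by
  obtain ⟨p₁, p₂, p₃⟩ := invariantFactors_dvd_of_addEquiv hd₁ hd₂ hd₃ hd₁₂ hd₂₃ he₁ he₂ he₃ f
  obtain ⟨q₁, q₂, q₃⟩ := invariantFactors_dvd_of_addEquiv he₁ he₂ he₃ he₁₂ he₂₃ hd₁ hd₂ hd₃ f.symm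
  have h₁ := Nat.dvd_antisymm p₁ q₁
  have h₂ := Nat.dvd_antisymm (p₂ h₁.symm) (q₂ h₁)
  exact ⟨h₁, h₂, Nat.dvd_antisymm (p₃ h₁.symm h₂.symm) (q₃ h₁ h₂)⟩

theorem map_commutator_mulEquiv {G H : Type*} [Group G] [Group H] (e : G ≃* H) :
    (commutator G).map e.toMonoidHom = commutator H := by
  rw [commutator_def, commutator_def, Subgroup.map_commutator,
    Subgroup.map_top_of_surjective _ e.surjective]

/-- Isomorphic groups have isomorphic quotients of the center by its intersection with the derived
group. -/
theorem nonempty_center_quotient_commutator_congr {G H : Type*} [Group G] [Group H] (e : G ≃* H) :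
    Nonempty ((Subgroup.center G ⧸ (commutator G).subgroupOf (Subgroup.center G)) ≃*
      (Subgroup.center H ⧸ (commutator H).subgroupOf (Subgroup.center H))) := by
  refine ⟨QuotientGroup.congr _ _ (Subgroup.centerCongr e) ?_⟩
  ext z
  obtain ⟨w, rfl⟩ := (Subgroup.centerCongr e).surjective z
  have h : ((Subgroup.centerCongr e w : Subgroup.center H) : H) = e.toMonoidHom w := rfl
  rw [Subgroup.mem_subgroupOf, h, ← map_commutator_mulEquiv e,
    Subgroup.mem_map_iff_mem e.injective, ← Subgroup.mem_subgroupOf]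
  exact Subgroup.mem_map_iff_mem (Subgroup.centerCongr e).injective

theorem TwistedLattice.eq_of_mulEquiv {d₁ d₂ d₃ e₁ e₂ e₃ : ℕ}
    (hd₁ : 1 ≤ d₁) (hd₂ : 1 ≤ d₂) (hd₃ : 1 ≤ d₃) (hd₁₂ : d₁ ∣ d₂) (hd₂₃ : d₂ ∣ d₃)
    (he₁ : 1 ≤ e₁) (he₂ : 1 ≤ e₂) (he₃ : 1 ≤ e₃) (he₁₂ : e₁ ∣ e₂) (he₂₃ : e₂ ∣ e₃)
    (f : TwistedLattice d₁ d₂ d₃ ≃* TwistedLattice e₁ e₂ e₃) :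
    d₁ = e₁ ∧ d₂ = e₂ ∧ d₃ = e₃ := by
  obtain ⟨p⟩ := nonempty_center_quotient_mulEquiv hd₂ hd₃
  obtain ⟨q⟩ := nonempty_center_quotient_mulEquiv he₂ he₃
  obtain ⟨r⟩ := nonempty_center_quotient_commutator_congr f
  exact invariantFactors_eq_of_addEquiv hd₁ hd₂ hd₃ hd₁₂ hd₂₃ he₁ he₂ he₃ he₁₂ he₂₃
    (MulEquiv.toAdditive ((p.symm.trans r).trans q))

/-! ### Realization of `Γ_d` as a lattice -/

namespace TwistedLattice

variable {d₁ d₂ d₃ : ℕ}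

/-- The embedding of `Γ_{d₁,d₂,d₃}` into `T* H₁(ℝ)` which divides the central coordinates by
`d₁, d₂, d₃`. -/
noncomputable def toCotangentHeisenberg (h₁ : 1 ≤ d₁) (h₂ : 1 ≤ d₂) (h₃ : 1 ≤ d₃) :
    TwistedLattice d₁ d₂ d₃ →* CotangentHeisenberg where
  toFun s := ⟨![s.a 0 / d₁, s.a 1 / d₂, s.a 2 / d₃], fun i => s.b i⟩
  map_one' := by
    ext i <;> fin_cases i <;> simp [one_def, CotangentHeisenberg.one_def]
  map_mul' s t := by
    have k₁ : (d₁ : ℝ) ≠ 0 := by exact_mod_cast (by omega : d₁ ≠ 0)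
    have k₂ : (d₂ : ℝ) ≠ 0 := by exact_mod_cast (by omega : d₂ ≠ 0)
    have k₃ : (d₃ : ℝ) ≠ 0 := by exact_mod_cast (by omega : d₃ ≠ 0)
    ext i <;> fin_cases i <;> simp [mul_def, CotangentHeisenberg.mul_def] <;> field_simp

theorem toCotangentHeisenberg_injective (h₁ : 1 ≤ d₁) (h₂ : 1 ≤ d₂) (h₃ : 1 ≤ d₃) :
    Function.Injective (toCotangentHeisenberg h₁ h₂ h₃) := by
  have k₁ : (d₁ : ℝ) ≠ 0 := by exact_mod_cast (by omega : d₁ ≠ 0)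
  have k₂ : (d₂ : ℝ) ≠ 0 := by exact_mod_cast (by omega : d₂ ≠ 0)
  have k₃ : (d₃ : ℝ) ≠ 0 := by exact_mod_cast (by omega : d₃ ≠ 0)
  intro s t h
  have hx := congrArg CotangentHeisenberg.x h
  have hy := congrArg CotangentHeisenberg.y h
  have x0 := congrFun hx 0
  have x1 := congrFun hx 1
  have x2 := congrFun hx 2
  simp [toCotangentHeisenberg, div_left_inj' k₁, div_left_inj' k₂, div_left_inj' k₃] at x0 x1 x2
  ext i
  · fin_cases i <;> simpa
  · have hi : (s.b i : ℝ) = t.b i := congrFun hy i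
    exact_mod_cast hi

theorem discreteTopology_range_toCotangentHeisenberg (h₁ : 1 ≤ d₁) (h₂ : 1 ≤ d₂) (h₃ : 1 ≤ d₃) :
    DiscreteTopology (toCotangentHeisenberg h₁ h₂ h₃).range := by
  have k₁ : (0 : ℝ) < d₁ := by exact_mod_cast h₁
  have k₂ : (0 : ℝ) < d₂ := by exact_mod_cast h₂
  have k₃ : (0 : ℝ) < d₃ := by exact_mod_cast h₃
  apply discreteTopology_of_isOpen_singleton_one
  have hx (i : Fin 3) : Continuous fun s : (toCotangentHeisenberg h₁ h₂ h₃).range => s.1.x i :=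
    (continuous_apply i).comp (CotangentHeisenberg.continuous_x.comp continuous_subtype_val)
  have hy (i : Fin 3) : Continuous fun s : (toCotangentHeisenberg h₁ h₂ h₃).range => s.1.y i :=
    (continuous_apply i).comp (CotangentHeisenberg.continuous_y.comp continuous_subtype_val)
  -- In this open box the integers `a i` and `b i` all have absolute value below `1`.
  have key : ({1} : Set (toCotangentHeisenberg h₁ h₂ h₃).range) =
      ((fun s => s.1.x 0 * (d₁ : ℝ)) ⁻¹' Set.Ioo (-1 : ℝ) 1 ∩
        (fun s => s.1.x 1 * (d₂ : ℝ)) ⁻¹' Set.Ioo (-1 : ℝ) 1 ∩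
        (fun s => s.1.x 2 * (d₃ : ℝ)) ⁻¹' Set.Ioo (-1 : ℝ) 1) ∩
      ((fun s => s.1.y 0) ⁻¹' Set.Ioo (-1 : ℝ) 1 ∩
        (fun s => s.1.y 1) ⁻¹' Set.Ioo (-1 : ℝ) 1 ∩
        (fun s => s.1.y 2) ⁻¹' Set.Ioo (-1 : ℝ) 1) := by
    apply Set.Subset.antisymm
    · rintro _ rfl
      simp [CotangentHeisenberg.one_def]
    · rintro ⟨_, s, rfl⟩ h
      have small {n : ℤ} (h : -1 < (n : ℝ) ∧ (n : ℝ) < 1) : n = 0 := by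
        have := h.1
        have := h.2
        norm_cast at *
        omega
      obtain ⟨⟨⟨a0, a1⟩, a2⟩, ⟨⟨b0, b1⟩, b2⟩⟩ := h
      have a0 : -1 < (s.a 0 : ℝ) / d₁ * d₁ ∧ (s.a 0 : ℝ) / d₁ * d₁ < 1 := a0
      have a1 : -1 < (s.a 1 : ℝ) / d₂ * d₂ ∧ (s.a 1 : ℝ) / d₂ * d₂ < 1 := a1
      have a2 : -1 < (s.a 2 : ℝ) / d₃ * d₃ ∧ (s.a 2 : ℝ) / d₃ * d₃ < 1 := a2
      rw [div_mul_cancel₀ _ k₁.ne'] at a0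
      rw [div_mul_cancel₀ _ k₂.ne'] at a1
      rw [div_mul_cancel₀ _ k₃.ne'] at a2
      have hs : s = 1 := by
        ext i
        · fin_cases i
          · exact small a0
          · exact small a1
          · exact small a2
        · fin_cases i
          · exact small b0
          · exact small b1
          · exact small b2
      subst hs
      exact Subtype.ext (map_one (toCotangentHeisenberg h₁ h₂ h₃))
  rw [key]
  exact (((isOpen_Ioo.preimage ((hx 0).mul_const _)).inter
    (isOpen_Ioo.preimage ((hx 1).mul_const _))).inter
      (isOpen_Ioo.preimage ((hx 2).mul_const _))).inter
    (((isOpen_Ioo.preimage (hy 0)).inter (isOpen_Ioo.preimage (hy 1))).inter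
      (isOpen_Ioo.preimage (hy 2)))

end TwistedLattice

namespace CotangentHeisenberg

theorem continuous_mk :
    Continuous fun p : (Fin 3 → ℝ) × (Fin 3 → ℝ) => (⟨p.1, p.2⟩ : CotangentHeisenberg) :=
  continuous_induced_rng.2 continuous_id

end CotangentHeisenberg

namespace TwistedLattice

variable {d₁ d₂ d₃ : ℕ}

/-- Every left coset meets the compact unit cube, so the quotient is a continuous image of it. -/
theorem compactSpace_quotient_range_toCotangentHeisenberg
    (h₁ : 1 ≤ d₁) (h₂ : 1 ≤ d₂) (h₃ : 1 ≤ d₃) :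
    CompactSpace (CotangentHeisenberg ⧸ (toCotangentHeisenberg h₁ h₂ h₃).range) := by
  have hd (d : ℕ) (h : 1 ≤ d) (r : ℝ) : r + (-⌊r * d⌋ : ℤ) / (d : ℝ) ∈ Set.Icc (0 : ℝ) 1 := by
    have k : (1 : ℝ) ≤ d := by exact_mod_cast h
    have e : r + (-⌊r * d⌋ : ℤ) / (d : ℝ) = Int.fract (r * d) / d := by
      rw [Int.fract]
      push_cast
      field_simp
      ring
    rw [e]
    exact ⟨div_nonneg (Int.fract_nonneg _) (by linarith),
      (div_le_one (by linarith)).2 ((Int.fract_lt_one _).le.trans k)⟩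
  let K : Set ((Fin 3 → ℝ) × (Fin 3 → ℝ)) := Set.Icc 0 1 ×ˢ Set.Icc 0 1
  have hK : IsCompact K := isCompact_Icc.prod isCompact_Icc
  have hq : Continuous fun p : (Fin 3 → ℝ) × (Fin 3 → ℝ) =>
      (QuotientGroup.mk (⟨p.1, p.2⟩ : CotangentHeisenberg) :
        CotangentHeisenberg ⧸ (toCotangentHeisenberg h₁ h₂ h₃).range) :=
    QuotientGroup.continuous_mk.comp CotangentHeisenberg.continuous_mk
  refine ⟨?_⟩
  convert hK.image hq
  refine (Set.eq_univ_of_forall fun q => ?_).symm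
  obtain ⟨g, rfl⟩ := QuotientGroup.mk_surjective q
  -- First `y` is reduced modulo `ℤ³`. The second factor is central, so it reduces `x` without
  -- disturbing `y`.
  let g' := g * toCotangentHeisenberg h₁ h₂ h₃ ⟨0, fun i => -⌊g.y i⌋⟩
  let g'' := g' * toCotangentHeisenberg h₁ h₂ h₃
    ⟨![-⌊g'.x 0 * d₁⌋, -⌊g'.x 1 * d₂⌋, -⌊g'.x 2 * d₃⌋], 0⟩
  refine ⟨(g''.x, g''.y), ⟨?_, ?_⟩, ?_⟩
  · have hx (i : Fin 3) : g''.x i ∈ Set.Icc (0 : ℝ) 1 := by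
      fin_cases i <;>
        simpa [g'', CotangentHeisenberg.mul_def, toCotangentHeisenberg] using hd _ ‹_› _
    exact ⟨fun i => (hx i).1, fun i => (hx i).2⟩
  · have hy (i : Fin 3) : g''.y i = Int.fract (g.y i) := by
      simp [g'', g', CotangentHeisenberg.mul_def, toCotangentHeisenberg, Int.fract, sub_eq_add_neg]
    exact ⟨fun i => (Int.fract_nonneg _).trans_eq (hy i).symm,
      fun i => (hy i).trans_le (Int.fract_lt_one _).le⟩
  · change (QuotientGroup.mk g'' :
      CotangentHeisenberg ⧸ (toCotangentHeisenberg h₁ h₂ h₃).range) = QuotientGroup.mk g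
    rw [QuotientGroup.mk_mul_of_mem _ (MonoidHom.mem_range.2 ⟨_, rfl⟩),
      QuotientGroup.mk_mul_of_mem _ (MonoidHom.mem_range.2 ⟨_, rfl⟩)]

theorem exists_isUniformLattice_mulEquiv (h₁ : 1 ≤ d₁) (h₂ : 1 ≤ d₂) (h₃ : 1 ≤ d₃) :
    ∃ Γ : Subgroup CotangentHeisenberg, IsUniformLattice Γ ∧
      Nonempty (Γ ≃* TwistedLattice d₁ d₂ d₃) :=
  ⟨(toCotangentHeisenberg h₁ h₂ h₃).range,
    ⟨discreteTopology_range_toCotangentHeisenberg h₁ h₂ h₃,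
      compactSpace_quotient_range_toCotangentHeisenberg h₁ h₂ h₃⟩,
    ⟨(MonoidHom.ofInjective (toCotangentHeisenberg_injective h₁ h₂ h₃)).symm⟩⟩

end TwistedLattice

/-! ### Smith normal form over `ℤ` in size three -/

open Matrix in
/-- Smith normal form of a nonsingular `3 × 3` integer matrix, without divisibility. -/
theorem Matrix.exists_diagonal_mul_of_det_ne_zero (C : Matrix (Fin 3) (Fin 3) ℤ) (hC : C.det ≠ 0) :
    ∃ (U B : Matrix (Fin 3) (Fin 3) ℤ) (a : Fin 3 → ℤ), IsUnit U.det ∧ IsUnit B.det ∧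
      U * C = diagonal a * B := by
  have hli : LinearIndependent ℤ C.row := Matrix.linearIndependent_rows_of_det_ne_zero hC
  let r := Module.Basis.span hli
  obtain ⟨b', a, ab', h⟩ := Submodule.exists_smith_normal_form_of_rank_eq (Pi.basisFun ℤ (Fin 3))
    (N := Submodule.span ℤ (Set.range C.row)) (by
      rw [Module.finrank_eq_card_basis r, Module.finrank_eq_card_basis (Pi.basisFun ℤ (Fin 3))])
  -- `ab' i = a i • b' i` is a basis of the row lattice of `C`, and `b'` one of `ℤ³`. `toMatrix`
  -- stores coordinates in columns, hence the transposes.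
  refine ⟨(r.toMatrix ab')ᵀ, ((Pi.basisFun ℤ (Fin 3)).toMatrix b')ᵀ, a, ?_, ?_, ?_⟩
  · rw [det_transpose]
    exact (Matrix.isUnit_iff_isUnit_det _).1
      (@isUnit_of_invertible _ _ _ (r.invertibleToMatrix ab'))
  · rw [det_transpose]
    exact (Matrix.isUnit_iff_isUnit_det _).1
      (@isUnit_of_invertible _ _ _ ((Pi.basisFun ℤ (Fin 3)).invertibleToMatrix b'))
  · ext i j
    rw [diagonal_mul, mul_apply]
    have hr (k : Fin 3) : (r k : Fin 3 → ℤ) = C.row k := by simp [r, Module.Basis.span_apply]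
    have e := congrArg (Submodule.span ℤ (Set.range C.row)).subtype (r.sum_toMatrix_smul_self ab' i)
    rw [map_sum, Submodule.subtype_apply, h] at e
    simpa [hr, Finset.sum_apply, Module.Basis.toMatrix_apply] using congrFun e j

theorem Int.exists_bezout_cofactors {a b : ℤ} (ha : a ≠ 0) :
    ∃ g x y p q : ℤ, a = g * p ∧ b = g * q ∧ x * p + y * q = 1 := by
  have hg : (Int.gcd a b : ℤ) ≠ 0 := by
    simp [Int.gcd_eq_zero_iff, ha]
  obtain ⟨p, hp⟩ := Int.gcd_dvd_left a b
  obtain ⟨q, hq⟩ := Int.gcd_dvd_right a b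
  refine ⟨Int.gcd a b, Int.gcdA a b, Int.gcdB a b, p, q, hp, hq, mul_left_cancel₀ hg ?_⟩
  have h := Int.gcd_eq_gcd_ab a b
  linear_combination (-1 : ℤ) * h - a.gcdA b * hp - a.gcdB b * hq

open Matrix in
/-- A diagonal integer matrix is equivalent to one whose diagonal entries divide each other. -/
theorem Matrix.exists_diagonal_dvd_chain (a : Fin 3 → ℤ) (h0 : a 0 ≠ 0) (h1 : a 1 ≠ 0) :
    ∃ (U B : Matrix (Fin 3) (Fin 3) ℤ) (c : Fin 3 → ℤ), U.det = 1 ∧ B.det = 1 ∧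
      c 0 ∣ c 1 ∧ c 1 ∣ c 2 ∧ U * diagonal a = diagonal c * B := by
  -- Three moves turn a pair of diagonal entries `gp, gq` into `g, gpq` (gcd and lcm up to sign),
  -- acting on positions `(0,1)`, `(0,2)` and `(1,2)`. With `xp + yq = 1`, both 2 × 2 factors `[x,
  -- y; -q, p]` and `[xp, yq; -1, 1]` have determinant `1`.
  obtain ⟨g, x, y, p, q, hp, hq, e⟩ := Int.exists_bezout_cofactors (b := a 1) h0
  have hg : g ≠ 0 := by rintro rfl; simp [h0] at hp
  obtain ⟨g', x', y', p', q', hp', hq', e'⟩ := Int.exists_bezout_cofactors (b := a 2) hg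
  have hl : g * p * q ≠ 0 := by
    rw [← hp]
    refine mul_ne_zero h0 ?_
    rintro rfl
    simp [h1] at hq
  obtain ⟨g'', x'', y'', p'', q'', hp'', hq'', e''⟩ :=
    Int.exists_bezout_cofactors (b := g' * p' * q') hl
  have e3 : (!![1, 0, 0; 0, x'', y''; 0, -q'', p''] : Matrix (Fin 3) (Fin 3) ℤ) *
      (!![x', 0, y'; 0, 1, 0; -q', 0, p'] * !![x, y, 0; -q, p, 0; 0, 0, 1]) * diagonal a =
      diagonal ![g', g'', g'' * p'' * q''] *
        ((!![1, 0, 0; 0, x'' * p'', y'' * q''; 0, -1, 1] : Matrix (Fin 3) (Fin 3) ℤ) *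
      (!![x' * p', 0, y' * q'; 0, 1, 0; -1, 0, 1] * !![x * p, y * q, 0; -1, 1, 0; 0, 0, 1])) := by
    have s1 : (!![x, y, 0; -q, p, 0; 0, 0, 1] : Matrix (Fin 3) (Fin 3) ℤ) * diagonal a =
        diagonal ![g, g * p * q, a 2] * !![x * p, y * q, 0; -1, 1, 0; 0, 0, 1] := by
      ext i j
      fin_cases i <;> fin_cases j <;> simp [hp, hq] <;> ring
    have s2 : (!![x', 0, y'; 0, 1, 0; -q', 0, p'] : Matrix (Fin 3) (Fin 3) ℤ) *
        diagonal ![g, g * p * q, a 2] =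
        diagonal ![g', g * p * q, g' * p' * q'] * !![x' * p', 0, y' * q'; 0, 1, 0; -1, 0, 1] := by
      generalize g * p * q = l
      ext i j
      fin_cases i <;> fin_cases j <;> simp [hp', hq'] <;> ring
    have s3 : (!![1, 0, 0; 0, x'', y''; 0, -q'', p''] : Matrix (Fin 3) (Fin 3) ℤ) *
        diagonal ![g', g * p * q, g' * p' * q'] =
        diagonal ![g', g'', g'' * p'' * q''] *
          !![1, 0, 0; 0, x'' * p'', y'' * q''; 0, -1, 1] := by
      rw [hp'', hq'']
      ext i j
      fin_cases i <;> fin_cases j <;> simp <;> ring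
    rw [Matrix.mul_assoc, Matrix.mul_assoc, s1,
      ← Matrix.mul_assoc _ _ (!![x * p, y * q, 0; -1, 1, 0; 0, 0, 1]), s2,
      Matrix.mul_assoc, ← Matrix.mul_assoc, s3, Matrix.mul_assoc]
  refine ⟨_, _, _, ?_, ?_, ?_, ?_, e3⟩
  · simp only [det_mul, det_fin_three, of_apply, cons_val]
    linear_combination (x * p + y * q) * (x' * p' + y' * q') * e'' +
      (x * p + y * q) * e' + e
  · simp only [det_mul, det_fin_three, of_apply, cons_val]
    linear_combination (x * p + y * q) * (x' * p' + y' * q') * e'' +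
      (x * p + y * q) * e' + e
  · -- `g'` divides both numbers with greatest common divisor `g''`
    change g' ∣ g''
    have : g'' = x'' * (g * p * q) + y'' * (g' * p' * q') := by
      linear_combination (-g'') * e'' - x'' * hp'' - y'' * hq''
    rw [this, hp']
    exact ⟨x'' * (p' * p * q) + y'' * (p' * q'), by ring⟩
  · exact ⟨p'' * q'', by simp [mul_assoc]⟩

open Matrix in
/-- Smith normal form of a nonsingular `3 × 3` integer matrix, with a left factor of
determinant `1`. -/
theorem Matrix.exists_smithNormalForm_fin_three (C : Matrix (Fin 3) (Fin 3) ℤ) (hC : C.det ≠ 0) :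
    ∃ (U B : Matrix (Fin 3) (Fin 3) ℤ) (d : Fin 3 → ℕ), U.det = 1 ∧ IsUnit B.det ∧
      (∀ i, 1 ≤ d i) ∧ d 0 ∣ d 1 ∧ d 1 ∣ d 2 ∧ U * C = diagonal (fun i => (d i : ℤ)) * B := by
  obtain ⟨U, B, a, hU, hB, h⟩ := exists_diagonal_mul_of_det_ne_zero C hC
  have hdet := congrArg det h
  rw [det_mul, det_mul, det_diagonal, Fin.prod_univ_three] at hdet
  have hne : a 0 * a 1 * a 2 * B.det ≠ 0 := by
    rw [← hdet]
    exact mul_ne_zero hU.ne_zero hC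
  obtain ⟨U', B', c, hU', hB', c01, c12, h'⟩ := exists_diagonal_dvd_chain a
    (by rintro h; simp [h] at hne) (by rintro h; simp [h] at hne)
  have hdet' := congrArg det h'
  rw [det_mul, det_mul, det_diagonal, det_diagonal, Fin.prod_univ_three, Fin.prod_univ_three, hU',
    hB', one_mul, mul_one] at hdet'
  rw [hdet'] at hne
  have hc (i : Fin 3) : c i ≠ 0 := by
    intro hi
    fin_cases i <;> simp at hi <;> simp [hi] at hne
  let σ : Fin 3 → ℤ := fun i => (c i).sign
  have hσ (i : Fin 3) : IsUnit (σ i) := by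
    rcases lt_or_gt_of_ne (hc i) with h | h
    · simp [σ, Int.sign_eq_neg_one_of_neg h]
    · simp [σ, Int.sign_eq_one_of_pos h]
  have hd : diagonal c = diagonal (fun i => ((c i).natAbs : ℤ)) * diagonal σ := by
    rw [diagonal_mul_diagonal]
    congr 1
    funext i
    rw [mul_comm]
    exact (Int.sign_mul_natAbs (c i)).symm
  -- The signs of the `c i` move into the right factor. Scaling by `U.det = ±1` makes the left
  -- determinant `U.det ^ 4 = 1`, as the size is odd.
  have hkey : (U.det • (U' * U)) * C = diagonal (fun i => ((c i).natAbs : ℤ)) *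
      (U.det • (diagonal σ * (B' * B))) := by
    rw [Matrix.mul_smul, Matrix.smul_mul, Matrix.mul_assoc, h, ← Matrix.mul_assoc, h', hd]
    simp only [Matrix.mul_assoc]
  refine ⟨_, _, _, ?_, ?_, ?_, ?_, ?_, hkey⟩
  · rw [det_smul, det_mul, hU']
    rcases Int.isUnit_iff.1 hU with h | h <;> simp [h]
  · rw [det_smul, det_mul, det_mul, hB', det_diagonal, Fin.prod_univ_three]
    simp [hU, hB, hσ]
  · intro i
    have := hc i
    omega
  · exact Int.natAbs_dvd_natAbs.2 c01
  · exact Int.natAbs_dvd_natAbs.2 c12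

/-! ### Homomorphisms from `Γ_d` to `G` -/

open Matrix

/-- The bilinear cocycle of the group law of `T* H₁`. -/
def heisenbergCocycle {R : Type*} [Mul R] (b c : Fin 3 → R) : Fin 3 → R :=
  ![b 1 * c 2, b 2 * c 0, b 0 * c 1]

@[simp]
theorem heisenbergCocycle_zero : heisenbergCocycle (0 : Fin 3 → ℝ) 0 = 0 := by
  ext i
  fin_cases i <;> simp [heisenbergCocycle]

theorem CotangentHeisenberg.mul_x (s t : CotangentHeisenberg) :
    (s * t).x = s.x + t.x + heisenbergCocycle s.y t.y := by
  ext i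
  fin_cases i <;> rfl

theorem CotangentHeisenberg.mul_y (s t : CotangentHeisenberg) : (s * t).y = s.y + t.y := rfl

/-- The symmetric bilinear form by which a linear change of the `y`-coordinates changes the
cocycle. -/
def cocycleDefect (V : Matrix (Fin 3) (Fin 3) ℝ) (b c : Fin 3 → ℝ) : Fin 3 → ℝ :=
  heisenbergCocycle (b ᵥ* V) (c ᵥ* V) - heisenbergCocycle b c ᵥ* V.adjugateᵀ

@[simp]
theorem cocycleDefect_zero (V : Matrix (Fin 3) (Fin 3) ℝ) : cocycleDefect V 0 0 = 0 := by
  simp [cocycleDefect]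

/-- Since `(bV) × (cV) = (b × c) cof V`, the defect has no skew part. The identity is polarization
of a symmetric bilinear form, with its mixed term unfolded. -/
theorem half_cocycleDefect_add (V : Matrix (Fin 3) (Fin 3) ℝ) (b c : Fin 3 → ℝ) :
    (1 / 2 : ℝ) • cocycleDefect V (b + c) (b + c) =
      (1 / 2 : ℝ) • cocycleDefect V b b + (1 / 2 : ℝ) • cocycleDefect V c c +
        (heisenbergCocycle (b ᵥ* V) (c ᵥ* V) - heisenbergCocycle b c ᵥ* V.adjugateᵀ) := by
  ext i
  fin_cases i <;>
    simp only [cocycleDefect, heisenbergCocycle, vecMul, dotProduct, Fin.sum_univ_three,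
      adjugate_fin_three, transpose_apply, of_apply, Pi.add_apply, Pi.sub_apply, Pi.smul_apply,
      smul_eq_mul, Fin.zero_eta, Fin.mk_one, Fin.reduceFinMk, cons_val] <;> ring

namespace TwistedLattice

/-- The homomorphism from `Γ_{d₁,d₂,d₃}` to `T* H₁(ℝ)` given by a matrix `V` of `y`-coordinates and
a matrix `P` of central coordinates related by `V.adjugateᵀ = diagonal d * P`; the matrix `N`
prescribes the central coordinates of the images of the generators. -/
noncomputable def homOfMatrix (d : Fin 3 → ℕ) (V P N : Matrix (Fin 3) (Fin 3) ℝ)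
    (h : V.adjugateᵀ = diagonal (fun i => (d i : ℝ)) * P) :
    TwistedLattice (d 0) (d 1) (d 2) →* CotangentHeisenberg where
  toFun s :=
    { x := (fun i => (s.a i : ℝ)) ᵥ* P +
        (1 / 2 : ℝ) • cocycleDefect V (fun i => (s.b i : ℝ)) (fun i => (s.b i : ℝ)) +
        (fun i => (s.b i : ℝ)) ᵥ* N
      y := (fun i => (s.b i : ℝ)) ᵥ* V }
  map_one' := by
    have h0 : (fun _ : Fin 3 => (0 : ℝ)) = 0 := rfl
    ext i <;>
      simp [one_def, CotangentHeisenberg.one_def, h0]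
  map_mul' s t := by
    have hb : (fun i => ((s * t).b i : ℝ)) = (fun i => (s.b i : ℝ)) + fun i => (t.b i : ℝ) := by
      ext i
      simp [mul_def]
    have ha : (fun i => ((s * t).a i : ℝ)) = (fun i => (s.a i : ℝ)) + (fun i => (t.a i : ℝ)) +
        heisenbergCocycle (fun i => (s.b i : ℝ)) (fun i => (t.b i : ℝ)) ᵥ*
          diagonal (fun i => (d i : ℝ)) := by
      ext i
      fin_cases i <;> simp [mul_def, heisenbergCocycle, vecMul_diagonal] <;> ring
    apply CotangentHeisenberg.ext
    · rw [CotangentHeisenberg.mul_x]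
      dsimp only
      -- By `h`, the cocycle of `Γ_d` pushed through `diagonal d * P` cancels the `V.adjugateᵀ` term
      -- of the defect. The `N` term is additive in `b`.
      rw [hb, ha, half_cocycleDefect_add, h, ← vecMul_vecMul,
        add_vecMul, add_vecMul, add_vecMul]
      abel
    · rw [CotangentHeisenberg.mul_y]
      dsimp only
      rw [hb, add_vecMul]

section Generators

variable {d₁ d₂ d₃ : ℕ}

theorem eq_top_of_generators_mem (K : Subgroup (TwistedLattice d₁ d₂ d₃))
    (hc : ∀ a : Fin 3 → ℤ, ⟨a, 0⟩ ∈ K) (hg : ∀ i : Fin 3, ⟨0, Pi.single i 1⟩ ∈ K) : K = ⊤ := by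
  rw [eq_top_iff]
  intro s _
  let p : TwistedLattice d₁ d₂ d₃ := ⟨0, Pi.single 0 1⟩ ^ s.b 0 * ⟨0, Pi.single 1 1⟩ ^ s.b 1 *
    ⟨0, Pi.single 2 1⟩ ^ s.b 2
  have hp : p ∈ K := mul_mem (mul_mem (zpow_mem (hg 0) _) (zpow_mem (hg 1) _)) (zpow_mem (hg 2) _)
  have hb : bHom p = bHom s := by
    apply Multiplicative.toAdd.injective
    have (i : Fin 3) : (bHom (⟨0, Pi.single i 1⟩ : TwistedLattice d₁ d₂ d₃)).toAdd =
      Pi.single i 1 := rfl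
    simp only [p, map_mul, map_zpow, toAdd_mul, toAdd_zpow, this]
    change _ = s.b
    ext i
    fin_cases i <;> simp
  have h1 : (s * p⁻¹).b = 0 := by
    change bHom (s * p⁻¹) = 1
    rw [map_mul, map_inv, hb, mul_inv_cancel]
  have h2 : s * p⁻¹ ∈ K := by
    have := hc (s * p⁻¹).a
    rwa [← h1] at this
  simpa using mul_mem h2 hp

end Generators

end TwistedLattice

theorem intCast_piSingle (i : Fin 3) :
    (fun j => ((Pi.single i 1 : Fin 3 → ℤ) j : ℝ)) = Pi.single i 1 := by
  ext j
  by_cases hj : j = i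
  · subst hj; simp
  · simp [hj]

theorem Matrix.intCast_vecMul_injective {P : Matrix (Fin 3) (Fin 3) ℝ} (hP : P.det ≠ 0)
    {a b : Fin 3 → ℤ} (h : (fun i => (a i : ℝ)) ᵥ* P = (fun i => (b i : ℝ)) ᵥ* P) : a = b := by
  have := Matrix.vecMul_injective_of_isUnit
    ((Matrix.isUnit_iff_isUnit_det P).2 (isUnit_iff_ne_zero.2 hP)) h
  ext i
  exact_mod_cast congrFun this i

/-- A subgroup of `T* H₁(ℝ)` whose projection and whose central part have bases related by the
matrix `diagonal d` is isomorphic to `Γ_{d₁,d₂,d₃}`. -/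
theorem CotangentHeisenberg.nonempty_mulEquiv_twistedLattice (Γ : Subgroup CotangentHeisenberg)
    (d : Fin 3 → ℕ) (V P : Matrix (Fin 3) (Fin 3) ℝ) (hV : V.det ≠ 0) (hP : P.det ≠ 0)
    (h : V.adjugateᵀ = diagonal (fun i => (d i : ℝ)) * P)
    (hL : ∀ y, (∃ g ∈ Γ, g.y = y) ↔ ∃ b : Fin 3 → ℤ, (fun i => (b i : ℝ)) ᵥ* V = y)
    (hM : ∀ x, ⟨x, 0⟩ ∈ Γ ↔ ∃ a : Fin 3 → ℤ, (fun i => (a i : ℝ)) ᵥ* P = x) :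
    Nonempty (Γ ≃* TwistedLattice (d 0) (d 1) (d 2)) := by
  have hlift (i : Fin 3) : ∃ g ∈ Γ, g.y = V i := by
    refine (hL _).2 ⟨Pi.single i 1, ?_⟩
    rw [intCast_piSingle, single_one_vecMul]
    rfl
  choose g hg hgy using hlift
  -- Subtracting the quadratic correction makes `φ` send the `i`-th generator exactly to the chosen
  -- lift `g i`.
  let N : Matrix (Fin 3) (Fin 3) ℝ := fun i =>
    (g i).x - (1 / 2 : ℝ) • cocycleDefect V (Pi.single i 1) (Pi.single i 1)
  let φ := TwistedLattice.homOfMatrix d V P N h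
  have h0 : (fun _ : Fin 3 => (0 : ℝ)) = 0 := rfl
  have hφc (a : Fin 3 → ℤ) : φ ⟨a, 0⟩ = ⟨(fun i => (a i : ℝ)) ᵥ* P, 0⟩ := by
    apply CotangentHeisenberg.ext <;>
      simp [φ, TwistedLattice.homOfMatrix, h0]
  have hφg (i : Fin 3) : φ ⟨0, Pi.single i 1⟩ = g i := by
    apply CotangentHeisenberg.ext
    · simp only [φ, TwistedLattice.homOfMatrix, MonoidHom.coe_mk, OneHom.coe_mk, intCast_piSingle,
        single_one_vecMul]
      simp [h0, N, Matrix.row]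
    · simp only [φ, TwistedLattice.homOfMatrix, MonoidHom.coe_mk, OneHom.coe_mk, intCast_piSingle,
        single_one_vecMul, hgy, Matrix.row]
  have hinj : Function.Injective φ := by
    intro s t hst
    have hb : s.b = t.b := intCast_vecMul_injective hV (congrArg CotangentHeisenberg.y hst)
    have hx := congrArg CotangentHeisenberg.x hst
    simp only [φ, TwistedLattice.homOfMatrix, MonoidHom.coe_mk, OneHom.coe_mk, hb,
      add_left_inj] at hx
    exact TwistedLattice.ext (intCast_vecMul_injective hP hx) hb
  have hmem (s) : φ s ∈ Γ := by
    have : Γ.comap φ = ⊤ := TwistedLattice.eq_top_of_generators_mem _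
      (fun a => by rw [Subgroup.mem_comap, hφc]; exact (hM _).2 ⟨a, rfl⟩)
      (fun i => by rw [Subgroup.mem_comap, hφg]; exact hg i)
    exact (this ▸ Subgroup.mem_top s : s ∈ Γ.comap φ)
  have hrange : φ.range = Γ := by
    apply le_antisymm
    · rintro _ ⟨s, rfl⟩
      exact hmem s
    · intro γ hγ
      obtain ⟨b, hb⟩ := (hL _).1 ⟨γ, hγ, rfl⟩
      -- Dividing by an element of the image with the same `y` leaves a central element, which `hM`
      -- covers.
      have hy : (γ * (φ ⟨0, b⟩)⁻¹).y = 0 := by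
        change γ.y + -((fun i => (b i : ℝ)) ᵥ* V) = 0
        rw [hb, add_neg_cancel]
      have hmem' : (⟨(γ * (φ ⟨0, b⟩)⁻¹).x, 0⟩ : CotangentHeisenberg) ∈ Γ := by
        rw [← hy]
        exact mul_mem hγ (inv_mem (hmem _))
      obtain ⟨a, ha⟩ := (hM _).1 hmem'
      refine ⟨⟨a, 0⟩ * ⟨0, b⟩, ?_⟩
      rw [map_mul, hφc, ← eq_mul_inv_iff_mul_eq]
      exact CotangentHeisenberg.ext ha hy.symm
  exact ⟨((MonoidHom.ofInjective hinj).trans (MulEquiv.subgroupCongr hrange)).symm⟩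

/-! ### Linear algebra and discrete subgroups of `ℝ³` -/

open Topology

theorem Matrix.exists_rows_mem_of_span_eq_top {S : Set (Fin 3 → ℝ)}
    (hS : Submodule.span ℝ S = ⊤) :
    ∃ V : Matrix (Fin 3) (Fin 3) ℝ, V.det ≠ 0 ∧ ∀ i, V i ∈ S := by
  obtain ⟨t, htS, hspan, hli⟩ := exists_linearIndependent ℝ S
  rw [hS] at hspan
  let b := Module.Basis.mk hli (by rw [Subtype.range_coe, hspan])
  have : Finite t := hli.finite
  have : Fintype t := Fintype.ofFinite t
  have hcard : Fintype.card t = Fintype.card (Fin 3) := by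
    rw [← Module.finrank_eq_card_basis b, Module.finrank_fintype_fun_eq_card]
  let e := Fintype.equivOfCardEq hcard
  let V : Matrix (Fin 3) (Fin 3) ℝ := fun i => (e.symm i : Fin 3 → ℝ)
  refine ⟨V, ?_, fun i => htS (e.symm i).2⟩
  have hV : LinearIndependent ℝ V.row := hli.comp e.symm e.symm.injective
  have := (Matrix.linearIndependent_rows_iff_isUnit.1 hV)
  exact ((Matrix.isUnit_iff_isUnit_det V).1 this).ne_zero

theorem Matrix.exists_vecMul_eq {V : Matrix (Fin 3) (Fin 3) ℝ} (hV : V.det ≠ 0)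
    (x : Fin 3 → ℝ) : ∃ c, c ᵥ* V = x :=
  ⟨x ᵥ* V⁻¹, by rw [vecMul_vecMul, nonsing_inv_mul _ (isUnit_iff_ne_zero.2 hV), vecMul_one]⟩

theorem Matrix.span_rows_eq_top {V : Matrix (Fin 3) (Fin 3) ℝ} (hV : V.det ≠ 0)
    {S : Set (Fin 3 → ℝ)} (h : ∀ i, V i ∈ S) : Submodule.span ℝ S = ⊤ := by
  rw [eq_top_iff]
  intro x _
  obtain ⟨c, rfl⟩ := exists_vecMul_eq hV x
  rw [vecMul_eq_sum]
  exact Submodule.sum_mem _ fun i _ => Submodule.smul_mem _ _ (Submodule.subset_span (h i))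

theorem Matrix.eq_zero_of_cross_rows_eq_zero {V : Matrix (Fin 3) (Fin 3) ℝ} (hV : V.det ≠ 0)
    {w : Fin 3 → ℝ} (h : ∀ i, crossProduct w (V i) = 0) : w = 0 := by
  have key (x : Fin 3 → ℝ) : crossProduct w x = 0 := by
    obtain ⟨c, rfl⟩ := exists_vecMul_eq hV x
    rw [vecMul_eq_sum, map_sum]
    refine Finset.sum_eq_zero fun i _ => ?_
    rw [map_smul, h, smul_zero]
  have h0 := key ![1, 0, 0]
  have h1 := key ![0, 1, 0]
  simp [cross_apply] at h0 h1
  ext i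
  fin_cases i <;> simp [h0, h1]

theorem AddSubgroup.discreteTopology_of_nhds {E : Type*} [AddGroup E] [TopologicalSpace E]
    [IsTopologicalAddGroup E] (H : AddSubgroup E) {U : Set E} (hU : U ∈ 𝓝 0)
    (h : ∀ x ∈ H, x ∈ U → x = 0) : DiscreteTopology H := by
  apply discreteTopology_of_isOpen_singleton_zero
  rw [isOpen_singleton_iff_nhds_eq_pure]
  refine le_antisymm (Filter.le_pure_iff.2 ?_) (pure_le_nhds 0)
  filter_upwards [continuous_subtype_val.continuousAt.preimage_mem_nhds (x := (0 : H)) hU] with x hx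
  exact Subtype.ext (h x x.2 hx)

/-- A discrete subgroup of `ℝ³` containing a basis of `ℝ³` is the integral row space of a
nonsingular matrix. -/
theorem AddSubgroup.exists_matrix_of_discreteTopology (H : AddSubgroup (Fin 3 → ℝ))
    [DiscreteTopology H] (hH : Submodule.span ℝ (H : Set (Fin 3 → ℝ)) = ⊤) :
    ∃ P : Matrix (Fin 3) (Fin 3) ℝ, P.det ≠ 0 ∧
      ∀ x, x ∈ H ↔ ∃ a : Fin 3 → ℤ, (fun i => (a i : ℝ)) ᵥ* P = x := by
  let L : Submodule ℤ (Fin 3 → ℝ) := AddSubgroup.toIntSubmodule H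
  have : DiscreteTopology L := ‹DiscreteTopology H›
  have : IsZLattice ℝ L := ⟨hH⟩
  have : Module.Finite ℤ L := ZLattice.module_finite ℝ L
  have : Module.Free ℤ L := ZLattice.module_free ℝ L
  have hrank : Module.finrank ℤ L = 3 := by
    rw [ZLattice.rank ℝ L, Module.finrank_fintype_fun_eq_card, Fintype.card_fin]
  let b := Module.finBasisOfFinrankEq ℤ L hrank
  let bR := b.ofZLatticeBasis ℝ L
  let P : Matrix (Fin 3) (Fin 3) ℝ := fun i => (b i : Fin 3 → ℝ)
  have hbP : ⇑bR = P := by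
    funext i
    exact b.ofZLatticeBasis_apply ℝ L i
  refine ⟨P, ?_, fun x => ?_⟩
  · have hP : LinearIndependent ℝ P.row := by
      change LinearIndependent ℝ P
      rw [← hbP]
      exact bR.linearIndependent
    exact ((Matrix.isUnit_iff_isUnit_det P).1
      (Matrix.linearIndependent_rows_iff_isUnit.1 hP)).ne_zero
  · have hL : x ∈ H ↔ x ∈ Submodule.span ℤ (Set.range bR) := by
      rw [b.ofZLatticeBasis_span ℝ L]
      rfl
    rw [hL, Submodule.mem_span_range_iff_exists_fun, hbP]
    refine exists_congr fun a => ?_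
    rw [vecMul_eq_sum]
    simp only [Int.cast_smul_eq_zsmul]

/-! ### Projection and central part of a lattice -/

namespace CotangentHeisenberg

/-- The central part of a subgroup. -/
def centralPart (Γ : Subgroup CotangentHeisenberg) : AddSubgroup (Fin 3 → ℝ) where
  carrier := {x | (⟨x, 0⟩ : CotangentHeisenberg) ∈ Γ}
  zero_mem' := one_mem Γ
  add_mem' {x x'} h h' := by
    have e : (⟨x, 0⟩ * ⟨x', 0⟩ : CotangentHeisenberg) = ⟨x + x', 0⟩ := by
      apply CotangentHeisenberg.ext <;> simp [mul_x, mul_y]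
    change (⟨x + x', 0⟩ : CotangentHeisenberg) ∈ Γ
    exact e ▸ mul_mem h h'
  neg_mem' {x} h := by
    have e : (⟨x, 0⟩⁻¹ : CotangentHeisenberg) = ⟨-x, 0⟩ := by
      ext i <;> fin_cases i <;> simp [inv_def]
    change (⟨-x, 0⟩ : CotangentHeisenberg) ∈ Γ
    exact e ▸ inv_mem h

theorem mem_centralPart {Γ : Subgroup CotangentHeisenberg} {x : Fin 3 → ℝ} :
    x ∈ centralPart Γ ↔ ⟨x, 0⟩ ∈ Γ := Iff.rfl

/-- The projection of a subgroup to the coordinates modulo the center. -/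
def projection (Γ : Subgroup CotangentHeisenberg) : AddSubgroup (Fin 3 → ℝ) where
  carrier := {y | ∃ g ∈ Γ, g.y = y}
  zero_mem' := ⟨1, one_mem Γ, rfl⟩
  add_mem' := by
    rintro _ _ ⟨g, hg, rfl⟩ ⟨g', hg', rfl⟩
    exact ⟨g * g', mul_mem hg hg', rfl⟩
  neg_mem' := by
    rintro _ ⟨g, hg, rfl⟩
    exact ⟨g⁻¹, inv_mem hg, rfl⟩

theorem commutator_eq (s t : CotangentHeisenberg) :
    s * t * s⁻¹ * t⁻¹ = ⟨crossProduct s.y t.y, 0⟩ := by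
  rw [mul_inv_eq_iff_eq_mul, mul_inv_eq_iff_eq_mul]
  ext i <;> fin_cases i <;> simp [mul_def, cross_apply] <;> ring

theorem cross_mem_centralPart {Γ : Subgroup CotangentHeisenberg} {y z : Fin 3 → ℝ}
    (hy : y ∈ projection Γ) (hz : z ∈ projection Γ) : crossProduct y z ∈ centralPart Γ := by
  obtain ⟨g, hg, rfl⟩ := hy
  obtain ⟨g', hg', rfl⟩ := hz
  rw [mem_centralPart, ← commutator_eq]
  exact mul_mem (mul_mem (mul_mem hg hg') (inv_mem hg)) (inv_mem hg')

/-- Otherwise a nonzero functional vanishes on the projection. It descends to a continuous function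
on the compact quotient, hence is bounded above, which is absurd. -/
theorem span_projection_eq_top {Γ : Subgroup CotangentHeisenberg}
    [CompactSpace (CotangentHeisenberg ⧸ Γ)] :
    Submodule.span ℝ (projection Γ : Set (Fin 3 → ℝ)) = ⊤ := by
  by_contra h
  obtain ⟨f, hf0, hf⟩ := Submodule.exists_le_ker_of_lt_top _ (lt_top_iff_ne_top.2 h)
  have hfc : Continuous fun g : CotangentHeisenberg => f g.y :=
    f.continuous_of_finiteDimensional.comp continuous_y
  have hinv (a b : CotangentHeisenberg) (hab : QuotientGroup.leftRel Γ a b) : f a.y = f b.y := by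
    rw [QuotientGroup.leftRel_apply] at hab
    have h0 : f (a⁻¹ * b).y = 0 := hf (Submodule.subset_span ⟨_, hab, rfl⟩)
    have h1 : (a⁻¹ * b).y = -a.y + b.y := rfl
    rw [h1, map_add, map_neg] at h0
    linarith
  let F : CotangentHeisenberg ⧸ Γ → ℝ := Quotient.lift (fun g => f g.y) hinv
  have hF : Continuous F := hfc.quotient_lift hinv
  obtain ⟨v, hv⟩ : ∃ v, f v ≠ 0 := by
    by_contra! hall
    exact hf0 (LinearMap.ext hall)
  obtain ⟨B, hB⟩ := (isCompact_range hF).bddAbove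
  have := hB ⟨QuotientGroup.mk ⟨0, ((B + 1) / f v) • v⟩, rfl⟩
  change f (((B + 1) / f v) • v) ≤ B at this
  rw [map_smul, smul_eq_mul, div_mul_cancel₀ _ hv] at this
  linarith

theorem exists_nhds_centralPart {Γ : Subgroup CotangentHeisenberg} [DiscreteTopology Γ] :
    ∃ U ∈ 𝓝 (0 : Fin 3 → ℝ), ∀ x ∈ centralPart Γ, x ∈ U → x = 0 := by
  obtain ⟨O, hO, hO1⟩ := isOpen_induced_iff.1 (isOpen_discrete ({1} : Set Γ))
  have hc : Continuous fun x : Fin 3 → ℝ => (⟨x, 0⟩ : CotangentHeisenberg) :=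
    continuous_mk.comp (continuous_id.prodMk continuous_const)
  have h1 : (1 : Γ) ∈ Subtype.val ⁻¹' O := hO1 ▸ rfl
  refine ⟨_, (hO.preimage hc).mem_nhds h1, fun x hx hxO => ?_⟩
  have h2 : (⟨⟨x, 0⟩, hx⟩ : Γ) ∈ Subtype.val ⁻¹' O := hxO
  rw [hO1] at h2
  exact congrArg (fun g : Γ => g.1.x) h2

/-- Projections of discrete subgroups need not be discrete; here commutators force it. For `y` near
`0` every `y × V i` is a small element of the central part, hence zero, and the rows of `V` form a
basis. -/
theorem exists_nhds_projection {Γ : Subgroup CotangentHeisenberg} [DiscreteTopology Γ]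
    {V : Matrix (Fin 3) (Fin 3) ℝ} (hV : V.det ≠ 0) (hVΓ : ∀ i, V i ∈ projection Γ) :
    ∃ U ∈ 𝓝 (0 : Fin 3 → ℝ), ∀ y ∈ projection Γ, y ∈ U → y = 0 := by
  obtain ⟨U, hU, hUΓ⟩ := exists_nhds_centralPart (Γ := Γ)
  have hc (i : Fin 3) : Continuous fun y : Fin 3 → ℝ => crossProduct y (V i) :=
    (crossProduct.flip (V i)).continuous_of_finiteDimensional
  refine ⟨⋂ i, (fun y => crossProduct y (V i)) ⁻¹' U, ?_, fun y hy hyU => ?_⟩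
  · refine Filter.iInter_mem.2 fun i => (hc i).continuousAt ?_
    simpa using hU
  · exact eq_zero_of_cross_rows_eq_zero hV fun i =>
      hUΓ _ (cross_mem_centralPart hy (hVΓ i)) (Set.mem_iInter.1 hyU i)

/-- The rows of the cofactor matrix are the cross products of the rows. -/
theorem adjugate_transpose_row_mem_centralPart {Γ : Subgroup CotangentHeisenberg}
    {V : Matrix (Fin 3) (Fin 3) ℝ} (hV : ∀ i, V i ∈ projection Γ) (i : Fin 3) :
    V.adjugateᵀ i ∈ centralPart Γ := by
  have h : V.adjugateᵀ i = crossProduct (V (i + 1)) (V (i + 2)) := by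
    ext j
    fin_cases i <;> fin_cases j <;> simp [adjugate_fin_three, cross_apply] <;> ring
  rw [h]
  exact cross_mem_centralPart (hV _) (hV _)

theorem det_adjugate_transpose_ne_zero {V : Matrix (Fin 3) (Fin 3) ℝ} (hV : V.det ≠ 0) :
    V.adjugateᵀ.det ≠ 0 := by
  rw [det_transpose, det_adjugate]
  exact pow_ne_zero _ hV

/-- The map `b ↦ b ᵥ* U` is a bijection of `ℤ³`: this is a change of lattice basis. -/
theorem integral_rowSpace_unimodular_mul (U : Matrix (Fin 3) (Fin 3) ℤ) (hU : IsUnit U.det)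
    (V : Matrix (Fin 3) (Fin 3) ℝ) (x : Fin 3 → ℝ) :
    (∃ b : Fin 3 → ℤ, (fun i => (b i : ℝ)) ᵥ* (U.map (Int.cast : ℤ → ℝ) * V) = x) ↔
      ∃ b : Fin 3 → ℤ, (fun i => (b i : ℝ)) ᵥ* V = x := by
  have hcast (b : Fin 3 → ℤ) : (fun i => (b i : ℝ)) ᵥ* U.map (Int.cast : ℤ → ℝ) =
      fun i => ((b ᵥ* U) i : ℝ) := by
    ext i
    simp [vecMul, dotProduct]
  constructor
  · rintro ⟨b, rfl⟩
    exact ⟨b ᵥ* U, by rw [← vecMul_vecMul, hcast]⟩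
  · rintro ⟨b, rfl⟩
    refine ⟨b ᵥ* U⁻¹, ?_⟩
    rw [← vecMul_vecMul, hcast, vecMul_vecMul, nonsing_inv_mul _ hU, vecMul_one]

theorem exists_mulEquiv_twistedLattice (Γ : Subgroup CotangentHeisenberg)
    (hΓ : IsUniformLattice Γ) :
    ∃ d₁ d₂ d₃ : ℕ, 1 ≤ d₁ ∧ 1 ≤ d₂ ∧ 1 ≤ d₃ ∧ d₁ ∣ d₂ ∧ d₂ ∣ d₃ ∧
      Nonempty (Γ ≃* TwistedLattice d₁ d₂ d₃) := by
  have := hΓ.discrete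
  have := hΓ.cocompact
  -- `V₀` is only an independent triple in the projection, used to prove discreteness and that the
  -- central part spans; `V` below is a `ℤ`-basis.
  obtain ⟨V₀, hV₀, hV₀Γ⟩ := exists_rows_mem_of_span_eq_top (span_projection_eq_top (Γ := Γ))
  obtain ⟨UM, hUM, hUM0⟩ := exists_nhds_centralPart (Γ := Γ)
  obtain ⟨UL, hUL, hUL0⟩ := exists_nhds_projection hV₀ hV₀Γ
  have := (centralPart Γ).discreteTopology_of_nhds hUM hUM0
  have := (projection Γ).discreteTopology_of_nhds hUL hUL0
  obtain ⟨V, hV, hL⟩ := (projection Γ).exists_matrix_of_discreteTopology span_projection_eq_top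
  obtain ⟨P, hP, hM⟩ := (centralPart Γ).exists_matrix_of_discreteTopology
    (span_rows_eq_top (det_adjugate_transpose_ne_zero hV₀)
      (adjugate_transpose_row_mem_centralPart hV₀Γ))
  have hVΓ (i : Fin 3) : V i ∈ projection Γ := by
    refine (hL _).2 ⟨Pi.single i 1, ?_⟩
    rw [intCast_piSingle, single_one_vecMul]
    rfl
  choose C hC using fun i => (hM _).1 (adjugate_transpose_row_mem_centralPart hVΓ i)
  let CM : Matrix (Fin 3) (Fin 3) ℤ := C
  have hCM : V.adjugateᵀ = CM.map (Int.cast : ℤ → ℝ) * P := by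
    ext i j
    rw [← hC i]
    rfl
  have hmap (A : Matrix (Fin 3) (Fin 3) ℤ) :
      (A.map (Int.cast : ℤ → ℝ)).det = (A.det : ℝ) := (Int.cast_det A).symm
  have hCdet : CM.det ≠ 0 := by
    intro h0
    have := det_adjugate_transpose_ne_zero hV
    rw [hCM, det_mul, hmap, h0] at this
    simp at this
  obtain ⟨U, B, d, hU, hB, hd, h01, h12, hUB⟩ := CM.exists_smithNormalForm_fin_three hCdet
  -- The new basis of the projection is `cof U * V`; its cofactor matrix is `U * cof V` because `cof
  -- (cof U) = U` when `det U = 1`.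
  have hU' : U.adjugateᵀ.det = 1 := by rw [det_transpose, det_adjugate, hU, one_pow]
  have hUU : (U.adjugateᵀ).adjugateᵀ = U := by
    rw [← adjugate_transpose, transpose_transpose, adjugate_adjugate _ (by simp), hU]
    simp
  have hBdet : ((B.det : ℤ) : ℝ) ≠ 0 := by exact_mod_cast hB.ne_zero
  refine ⟨d 0, d 1, d 2, hd 0, hd 1, hd 2, h01, h12,
    nonempty_mulEquiv_twistedLattice Γ d (U.adjugateᵀ.map (Int.cast : ℤ → ℝ) * V)
      (B.map (Int.cast : ℤ → ℝ) * P) ?_ ?_ ?_ ?_ ?_⟩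
  · rw [det_mul, hmap, hU', Int.cast_one, one_mul]
    exact hV
  · rw [det_mul, hmap]
    exact mul_ne_zero hBdet hP
  · have e1 : (U.adjugateᵀ.map (Int.cast : ℤ → ℝ)).adjugateᵀ = U.map (Int.cast : ℤ → ℝ) := by
      have := RingHom.map_adjugate (Int.castRingHom ℝ) U.adjugateᵀ
      change (U.adjugateᵀ.adjugate).map (Int.cast : ℤ → ℝ) = _ at this
      conv_rhs => rw [← hUU]
      exact (congrArg transpose this).symm
    have e2 := congrArg (fun A : Matrix (Fin 3) (Fin 3) ℤ => A.map (Int.castRingHom ℝ)) hUB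
    simp only [Matrix.map_mul] at e2
    have e3 : (diagonal fun i => (d i : ℤ)).map (Int.castRingHom ℝ) =
        diagonal fun i => (d i : ℝ) := by
      rw [diagonal_map (map_zero _)]
      simp
    rw [e3] at e2
    rw [adjugate_mul_distrib, transpose_mul, e1, hCM, ← Matrix.mul_assoc, ← Matrix.mul_assoc]
    exact congrArg (· * P) e2
  · intro y
    rw [integral_rowSpace_unimodular_mul _ (by rw [hU']; exact isUnit_one), ← hL y]
    rfl
  · intro x
    rw [integral_rowSpace_unimodular_mul _ hB, ← hM x]
    rfl

end CotangentHeisenberg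

theorem theorem2 :
    -- every lattice is isomorphic to some `Γ_{d₁,d₂,d₃}` with `1 ≤ d₁ ∣ d₂ ∣ d₃`
    (∀ Γ : Subgroup CotangentHeisenberg, IsUniformLattice Γ →
      ∃ d₁ d₂ d₃ : ℕ, 1 ≤ d₁ ∧ 1 ≤ d₂ ∧ 1 ≤ d₃ ∧ d₁ ∣ d₂ ∧ d₂ ∣ d₃ ∧
        Nonempty (Γ ≃* TwistedLattice d₁ d₂ d₃)) ∧
    -- every such `Γ_{d₁,d₂,d₃}` is isomorphic to a lattice
    (∀ d₁ d₂ d₃ : ℕ, 1 ≤ d₁ → 1 ≤ d₂ → 1 ≤ d₃ → d₁ ∣ d₂ → d₂ ∣ d₃ →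
      ∃ Γ : Subgroup CotangentHeisenberg, IsUniformLattice Γ ∧
        Nonempty (Γ ≃* TwistedLattice d₁ d₂ d₃)) ∧
    -- the derived group is central, and center modulo derived group is `C_{d₁} × C_{d₂} × C_{d₃}`
    (∀ d₁ d₂ d₃ : ℕ, 1 ≤ d₁ → 1 ≤ d₂ → 1 ≤ d₃ → d₁ ∣ d₂ → d₂ ∣ d₃ →
      commutator (TwistedLattice d₁ d₂ d₃) ≤ Subgroup.center (TwistedLattice d₁ d₂ d₃) ∧
      Nonempty
        ((Subgroup.center (TwistedLattice d₁ d₂ d₃) ⧸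
            (commutator (TwistedLattice d₁ d₂ d₃)).subgroupOf
              (Subgroup.center (TwistedLattice d₁ d₂ d₃))) ≃*
          Multiplicative (ZMod d₁ × ZMod d₂ × ZMod d₃))) ∧
    -- different triples give non-isomorphic groups
    (∀ d₁ d₂ d₃ e₁ e₂ e₃ : ℕ,
      1 ≤ d₁ → 1 ≤ d₂ → 1 ≤ d₃ → d₁ ∣ d₂ → d₂ ∣ d₃ →
      1 ≤ e₁ → 1 ≤ e₂ → 1 ≤ e₃ → e₁ ∣ e₂ → e₂ ∣ e₃ →
      Nonempty (TwistedLattice d₁ d₂ d₃ ≃* TwistedLattice e₁ e₂ e₃) →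
      d₁ = e₁ ∧ d₂ = e₂ ∧ d₃ = e₃) := by
  refine ⟨CotangentHeisenberg.exists_mulEquiv_twistedLattice, ?_, ?_, ?_⟩
  · intro d₁ d₂ d₃ h₁ h₂ h₃ _ _
    exact TwistedLattice.exists_isUniformLattice_mulEquiv h₁ h₂ h₃
  · intro d₁ d₂ d₃ _ h₂ h₃ _ _
    exact ⟨TwistedLattice.commutator_le_center h₂ h₃,
      TwistedLattice.nonempty_center_quotient_mulEquiv h₂ h₃⟩
  · rintro d₁ d₂ d₃ e₁ e₂ e₃ hd₁ hd₂ hd₃ hd₁₂ hd₂₃ he₁ he₂ he₃ he₁₂ he₂₃ ⟨f⟩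
    exact TwistedLattice.eq_of_mulEquiv hd₁ hd₂ hd₃ hd₁₂ hd₂₃ he₁ he₂ he₃ he₁₂ he₂₃ f
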